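/- Let $G$ be a finite simple graph with Laplacian matrix $L=\Delta-A$ (degree matrix minus adjacency matrix), let $U(t)=\exp(itL)$, and let $e_v$ denote the characteristic vector of a vertex $v$. For $a\neq b$, $c\neq d$ with $\{a,b\}\neq\{c,d\}$, we say that $G$ has perfect (Laplacian) pair state transfer between the pairs $\{a,b\}$ and $\{c,d\}$ at time $t\ge 0$ if $U(t)(e_a-e_b)=\gamma(e_c-e_d)$ for some complex number $\gamma$ with $|\gamma|=1$. Let $P_n$ denote the path on $n$ vertices $1,2,\dots,n$, where consecutive integers are adjacent. Theorem. The path $P_n$ has, at some time $t\ge 0$, perfect pair state transfer between two pairs at least one of which is an edge, if and only if $n=3$ or $n=4$. Moreover, in $P_3$ the only two pairs, at least one of them an edge, between which there is perfect pair state transfer are the two edges $\{1,2\}$ and $\{2,3\}$, and the transfer between them occurs at time $\pi/2$; in $P_4$ the only two such pairs are the two end edges $\{1,2\}$ and $\{3,4\}$, and the transfer between them occurs at time $\sqrt{2}\,\pi/2$. -/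

import Mathlib

noncomputable section

/-- The transition matrix `U(t) = exp(itL)` of the continuous quantum walk on `G` whose Hamiltonian
is the Laplacian matrix `L` of `G`. -/
def lapTransition {V : Type*} [Fintype V] [DecidableEq V] (G : SimpleGraph V)
    [DecidableRel G.Adj] (t : ℝ) : Matrix V V ℂ :=
  NormedSpace.exp ((Complex.I * (t : ℂ)) • G.lapMatrix ℂ)

/-- The (unnormalized) pair state `e_a - e_b`. -/
def pairState {V : Type*} [DecidableEq V] (a b : V) : V → ℂ :=
  Pi.single a 1 - Pi.single b 1

/-- Perfect Laplacian pair state transfer in `G` from the pair `{a, b}` to the pair `{c, d}` at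
time `t`: the two pairs are different pairs of distinct vertices, `t` is nonnegative, and
`U(t)(e_a - e_b) = γ (e_c - e_d)` for a complex number `γ` of modulus one. -/
def PairTransferAt {V : Type*} [Fintype V] [DecidableEq V] (G : SimpleGraph V)
    [DecidableRel G.Adj] (t : ℝ) (a b c d : V) : Prop :=
  a ≠ b ∧ c ≠ d ∧ s(a, b) ≠ s(c, d) ∧ 0 ≤ t ∧
    ∃ γ : ℂ, ‖γ‖ = 1 ∧
      Matrix.mulVec (lapTransition G t) (pairState a b) = γ • pairState c d

/-- Perfect Laplacian pair state transfer from `{a, b}` to `{c, d}` at some time. -/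
def PairTransfer {V : Type*} [Fintype V] [DecidableEq V] (G : SimpleGraph V)
    [DecidableRel G.Adj] (a b c d : V) : Prop :=
  ∃ t : ℝ, PairTransferAt G t a b c d

/-- `pathGraph n` is the path on the vertices `0, 1, …, n - 1`, consecutive ones being adjacent. -/
instance pathGraphDecidableAdj (n : ℕ) : DecidableRel (SimpleGraph.pathGraph n).Adj :=
  fun _ _ => decidable_of_iff' _ SimpleGraph.pathGraph_adj

end

/-!
The Laplacian eigenvectors of `P_n` are the sampled cosines
`v_k(j) = cos ((2j + 1) k π / (2n))`, `0 ≤ k < n`, with eigenvalues `2 - 2 cos (k π / n)`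
(`lapMatrix_pathGraph_mulVec_pathCos`). Pairing `U(t)(e_a - e_b) = γ (e_c - e_d)` with `v_k` gives
one scalar equation for each `k` (`exp_mul_sub_of_eigen`).

The walk conserves the energy `⟨x, L x⟩`, which on `P_n`, `n ≥ 3`, is at least `5` for the pair
state of an edge and at most `4` for that of any other pair. So a transfer that involves an edge is
a transfer between two edges (`PairTransferAt.adj_of_adj`). If these are `{p - 1, p}` and
`{q - 1, q}`, vertices being counted from `0`, the `k`-th equation reads
`exp (i t (2 - 2 cos (k π / n))) sin (k p π / n) = γ sin (k q π / n)` (`exp_mul_sin_of_transfer`).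
Absolute values for `k = 1` give `sin (p π / n) = sin (q π / n)`, so `p + q = n`: the edges are
mirror images. Then `2 p ≠ n`, so no sine vanishes for `k = 1, 2, n - 1, n - 2`; squaring these four
equations and dividing shows that `4 t cos (π / n)` and `4 t cos (2π / n)` are integer multiples
of `π`, whence `r = cos (2π / n) / cos (π / n)` is rational
(`PairTransferAt.add_eq_and_eq_three_or_four`).

The algebraic integer `x = 2 cos (π / n)` lies in `[1, 2)` and satisfies `x² = r x + 2`. Either `x`
is an integer, hence `1`, or `r` is an integer, because `X² - r X - 2` is the minimal polynomial
of `x`; then `r = x - 2 / x` lies in `[-1, 1)`, so `x = 1` or `x = √2`. Thus `n = 3` or `n = 4`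
(`eq_three_or_four_of_cos_ratio`). In these two paths the end edges are the only distinct mirror
images of each other, and their transfer is computed by decomposing `e_0 - e_1` into eigenvectors.
-/

open scoped Matrix

/-! ### The transition matrix of a graph -/

section Transition

theorem pairState_swap {V : Type*} [DecidableEq V] (a b : V) : pairState b a = -pairState a b :=
  (neg_sub _ _).symm

theorem star_pairState {V : Type*} [DecidableEq V] (a b : V) :
    star (pairState a b) = pairState a b := by
  simp [pairState]

variable {V : Type*} [Fintype V] [DecidableEq V]

theorem Matrix.exp_mulVec_of_mulVec_eq_smul {M : Matrix V V ℂ} {v : V → ℂ} {z : ℂ}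
    (h : M *ᵥ v = z • v) : NormedSpace.exp M *ᵥ v = Complex.exp z • v := by
  -- Matrices carry no global norm; any submultiplicative one makes the exponential series converge.
  let : NormedRing (Matrix V V ℂ) := Matrix.linftyOpNormedRing
  let : NormedAlgebra ℂ (Matrix V V ℂ) := Matrix.linftyOpNormedAlgebra
  have hpow : ∀ k : ℕ, (M ^ k) *ᵥ v = z ^ k • v := fun k => by
    induction k with
    | zero => simp
    | succ k ih => rw [pow_succ, ← Matrix.mulVec_mulVec, h, Matrix.mulVec_smul, ih, smul_smul,
        ← pow_succ']
  have h1 := (NormedSpace.exp_series_hasSum_exp' (𝕂 := ℂ) M).map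
    ((Matrix.mulVecBilin ℂ ℂ).flip v : Matrix V V ℂ →ₗ[ℂ] V → ℂ)
    (LinearMap.continuous_of_finiteDimensional _)
  have h2 := (NormedSpace.exp_series_hasSum_exp' (𝕂 := ℂ) z).smul_const v
  rw [Complex.exp_eq_exp_ℂ]
  refine h1.unique ?_
  convert h2 using 1
  funext k
  simp [hpow, smul_smul]

variable (G : SimpleGraph V) [DecidableRel G.Adj]

theorem lapTransition_transpose (t : ℝ) : (lapTransition G t)ᵀ = lapTransition G t := by
  rw [lapTransition, ← Matrix.exp_transpose, Matrix.transpose_smul,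
    (G.isSymm_lapMatrix (R := ℂ)).eq]

theorem lapTransition_conjTranspose (t : ℝ) :
    (lapTransition G t)ᴴ = lapTransition G (-t) := by
  rw [lapTransition, lapTransition, ← Matrix.exp_conjTranspose, Matrix.conjTranspose_smul,
    (G.isHermitian_lapMatrix (R := ℂ)).eq]
  simp

theorem lapTransition_mul_neg (t : ℝ) :
    lapTransition G t * lapTransition G (-t) = 1 := by
  rw [lapTransition, lapTransition, ← Matrix.exp_add_of_commute]
  · rw [← add_smul]
    simp
  · exact ((Commute.refl _).smul_left _).smul_right _

theorem lapTransition_mul_lapMatrix (t : ℝ) :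
    lapTransition G t * G.lapMatrix ℂ = G.lapMatrix ℂ * lapTransition G t := by
  let : NormedRing (Matrix V V ℂ) := Matrix.linftyOpNormedRing
  let : NormedAlgebra ℂ (Matrix V V ℂ) := Matrix.linftyOpNormedAlgebra
  exact (((Commute.refl (G.lapMatrix ℂ)).smul_left _).exp_left).eq

variable {G}

theorem lapTransition_mulVec_of_eigen {v : V → ℂ} {z : ℂ} (h : G.lapMatrix ℂ *ᵥ v = z • v)
    (t : ℝ) : lapTransition G t *ᵥ v = Complex.exp (Complex.I * t * z) • v :=
  Matrix.exp_mulVec_of_mulVec_eq_smul (by rw [Matrix.smul_mulVec, h, smul_smul])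

/-- Pair states are real vectors, so conjugating a transfer reverses time. -/
theorem lapTransition_neg_mulVec_pairState {t : ℝ} {a b c d : V} {γ : ℂ}
    (hU : lapTransition G t *ᵥ pairState a b = γ • pairState c d) :
    lapTransition G (-t) *ᵥ pairState a b = star γ • pairState c d := by
  have h := congrArg star hU
  rwa [Matrix.star_mulVec, lapTransition_conjTranspose, ← Matrix.mulVec_transpose,
    lapTransition_transpose, star_smul, star_pairState, star_pairState] at h

namespace PairTransferAt

variable {t : ℝ} {a b c d : V}

theorem swap_left (h : PairTransferAt G t a b c d) : PairTransferAt G t b a c d := by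
  obtain ⟨hab, hcd, hne, ht, γ, hγ, hU⟩ := h
  refine ⟨hab.symm, hcd, by rwa [Sym2.eq_swap], ht, -γ, by simpa using hγ, ?_⟩
  rw [pairState_swap, Matrix.mulVec_neg, hU, neg_smul]

theorem swap_right (h : PairTransferAt G t a b c d) : PairTransferAt G t a b d c := by
  obtain ⟨hab, hcd, hne, ht, γ, hγ, hU⟩ := h
  refine ⟨hab, hcd.symm, by rwa [Sym2.eq_swap (a := d)], ht, -γ, by simpa using hγ, ?_⟩
  rw [pairState_swap c d, hU, neg_smul, smul_neg, neg_neg]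

/-- Whether transfer takes place depends on the two pairs only, not on how they are ordered. -/
theorem congr_sym2 {a' b' c' d' : V} (h : PairTransferAt G t a b c d)
    (h₁ : s(a, b) = s(a', b')) (h₂ : s(c, d) = s(c', d')) : PairTransferAt G t a' b' c' d' := by
  rcases Sym2.eq_iff.1 h₁ with ⟨rfl, rfl⟩ | ⟨rfl, rfl⟩ <;>
    rcases Sym2.eq_iff.1 h₂ with ⟨rfl, rfl⟩ | ⟨rfl, rfl⟩
  exacts [h, h.swap_right, h.swap_left, h.swap_left.swap_right]

theorem symm (h : PairTransferAt G t a b c d) : PairTransferAt G t c d a b := by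
  obtain ⟨hab, hcd, hne, ht, γ, hγ, hU⟩ := h
  refine ⟨hcd, hab, hne.symm, ht, γ, hγ, ?_⟩
  have h1 := congrArg (lapTransition G t *ᵥ ·) (lapTransition_neg_mulVec_pairState hU)
  have hγ' : γ * star γ = 1 := by
    simp [Complex.mul_conj, Complex.normSq_eq_norm_sq, hγ]
  simp only [Matrix.mulVec_mulVec, lapTransition_mul_neg, Matrix.one_mulVec,
    Matrix.mulVec_smul] at h1
  rw [h1, smul_smul, hγ', one_smul]

/-- The expected energy `⟨x, L x⟩` is conserved by the walk, hence equal for the two pairs. -/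
theorem energy_eq (h : PairTransferAt G t a b c d) :
    pairState a b ⬝ᵥ G.lapMatrix ℂ *ᵥ pairState a b =
      pairState c d ⬝ᵥ G.lapMatrix ℂ *ᵥ pairState c d := by
  obtain ⟨hab, hcd, hne, ht, γ, hγ, hU⟩ := h
  have hγ' : γ * star γ = 1 := by
    simp [Complex.mul_conj, Complex.normSq_eq_norm_sq, hγ]
  have h1 : (lapTransition G t *ᵥ pairState a b) ⬝ᵥ
      G.lapMatrix ℂ *ᵥ (lapTransition G (-t) *ᵥ pairState a b) =
      pairState c d ⬝ᵥ G.lapMatrix ℂ *ᵥ pairState c d := by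
    rw [hU, lapTransition_neg_mulVec_pairState hU, Matrix.mulVec_smul, smul_dotProduct,
      dotProduct_smul, smul_smul, hγ', one_smul]
  rw [← h1, ← Matrix.vecMul_transpose (lapTransition G t), lapTransition_transpose,
    ← Matrix.dotProduct_mulVec,
    Matrix.mulVec_mulVec, Matrix.mulVec_mulVec, lapTransition_mul_lapMatrix,
    mul_assoc, lapTransition_mul_neg, mul_one]

end PairTransferAt

theorem pairState_dotProduct_lapMatrix {a b : V} (h : a ≠ b) :
    pairState a b ⬝ᵥ G.lapMatrix ℂ *ᵥ pairState a b =
      ((G.degree a + G.degree b + if G.Adj a b then 2 else 0 : ℕ) : ℂ) := by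
  by_cases hab : G.Adj a b
  · simp [pairState, Matrix.mulVec_sub, sub_dotProduct, SimpleGraph.lapMatrix,
      SimpleGraph.degMatrix, h, h.symm, hab, G.adj_comm b a]
    ring
  · simp [pairState, Matrix.mulVec_sub, sub_dotProduct, SimpleGraph.lapMatrix,
      SimpleGraph.degMatrix, h, h.symm, hab, G.adj_comm b a]

theorem dotProduct_pairState (v : V → ℂ) (a b : V) : v ⬝ᵥ pairState a b = v a - v b := by
  simp [pairState, dotProduct_sub]

/-- Pairing the transfer equation with a Laplacian eigenvector. -/
theorem exp_mul_sub_of_eigen {v : V → ℂ} {z : ℂ} (hv : G.lapMatrix ℂ *ᵥ v = z • v) {t : ℝ}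
    {γ : ℂ} {a b c d : V} (hU : lapTransition G t *ᵥ pairState a b = γ • pairState c d) :
    Complex.exp (Complex.I * t * z) * (v a - v b) = γ * (v c - v d) := by
  rw [← dotProduct_pairState, ← dotProduct_pairState, ← smul_eq_mul (a := γ), ← smul_eq_mul,
    ← smul_dotProduct, ← dotProduct_smul, ← hU, Matrix.dotProduct_mulVec,
    ← Matrix.mulVec_transpose, lapTransition_transpose, lapTransition_mulVec_of_eigen hv]

end Transition

/-! ### The Laplacian of a path -/

section Path

open SimpleGraph

/-- A sum over the neighbours of a vertex of the path. -/
theorem sum_neighborFinset_pathGraph {M : Type*} [AddCommMonoid M] {n : ℕ} (i : Fin n)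
    (f : ℕ → M) :
    ∑ j ∈ (pathGraph n).neighborFinset i, f j =
      (if (i : ℕ) + 1 < n then f (i + 1) else 0) + if 0 < (i : ℕ) then f (i - 1) else 0 := by
  have h : ∀ j : ℕ, (if (i : ℕ) + 1 = j ∨ j + 1 = i then f j else 0) =
      (if (i : ℕ) + 1 = j then f j else 0) +
        if (i : ℕ) - 1 = j then (if 0 < (i : ℕ) then f j else 0) else 0 := by
    intro j
    split_ifs <;> first | omega | simp
  rw [neighborFinset_eq_filter, Finset.sum_filter]
  simp only [pathGraph_adj]
  rw [Fin.sum_univ_eq_sum_range (fun j => if (i : ℕ) + 1 = j ∨ j + 1 = i then f j else 0) n]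
  simp only [h]
  have hlt : (i : ℕ) - 1 < n := by omega
  simp only [Finset.sum_add_distrib, Finset.sum_ite_eq, Finset.mem_range, if_pos hlt]

theorem degree_pathGraph {n : ℕ} (i : Fin n) :
    (pathGraph n).degree i =
      (if (i : ℕ) + 1 < n then 1 else 0) + if 0 < (i : ℕ) then 1 else 0 := by
  rw [← sum_neighborFinset_pathGraph i (fun _ => 1), Finset.sum_const, smul_eq_mul, mul_one,
    card_neighborFinset_eq_degree]

/-- The energy of a pair state on a path is at least `5` for an edge and at most `4`
otherwise, so an edge can be transferred to an edge only. -/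
theorem PairTransferAt.adj_of_adj {n : ℕ} {t : ℝ} {a b c d : Fin n}
    (h : PairTransferAt (pathGraph n) t a b c d) (hab : (pathGraph n).Adj a b) :
    (pathGraph n).Adj c d := by
  by_contra hcd
  have he := h.energy_eq
  obtain ⟨h1, h2, h3, -⟩ := h
  rw [pairState_dotProduct_lapMatrix h1, pairState_dotProduct_lapMatrix h2, if_pos hab,
    if_neg hcd] at he
  have he := Nat.cast_injective he
  rw [degree_pathGraph, degree_pathGraph, degree_pathGraph, degree_pathGraph] at he
  rw [pathGraph_adj] at hab hcd
  simp only [ne_eq, Fin.ext_iff] at h1 h2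
  have := a.2
  have := b.2
  have := c.2
  have := d.2
  split_ifs at he <;> omega

/-- The `k`-th Laplacian eigenvector of the path: the sampled cosine `cos ((2 j + 1) k π / (2 n))`
(the discrete cosine transform), here with the step `β = k π / (2 n)` as the parameter. -/
noncomputable def pathCos (n : ℕ) (β : ℝ) : Fin n → ℂ :=
  fun j => ((Real.cos ((2 * (j : ℕ) + 1) * β) : ℝ) : ℂ)

/-- The reflections of `j ↦ cos ((2 j + 1) β)` in `j = -1/2` and, if `2 n β` is a multiple of `π`,
in `j = n - 1/2` make the eigenvalue equation of the line hold at the two ends as well. -/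
theorem lapMatrix_pathGraph_mulVec_pathCos {n k : ℕ} {β : ℝ} (hβ : 2 * n * β = k * Real.pi) :
    (pathGraph n).lapMatrix ℂ *ᵥ pathCos n β =
      ((2 - 2 * Real.cos (2 * β) : ℝ) : ℂ) • pathCos n β := by
  funext i
  rw [lapMatrix_mulVec_apply, degree_pathGraph]
  have hs := sum_neighborFinset_pathGraph i
    (fun j => ((Real.cos ((2 * (j : ℕ) + 1) * β) : ℝ) : ℂ))
  simp only [pathCos, Pi.smul_apply, smul_eq_mul]
  rw [hs]
  have hi := i.2
  set j : ℕ := (i : ℕ)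
  have hadd : Real.cos ((2 * (j + 1 : ℝ) + 1) * β) + Real.cos ((2 * (j - 1 : ℝ) + 1) * β) =
      2 * Real.cos (2 * β) * Real.cos ((2 * j + 1) * β) := by
    rw [Real.cos_add_cos]
    ring_nf
  have hleft : j = 0 → Real.cos ((2 * (j - 1 : ℝ) + 1) * β) = Real.cos ((2 * j + 1) * β) := by
    intro h0
    rw [h0, ← Real.cos_neg]
    push_cast
    ring_nf
  have hright : j + 1 = n →
      Real.cos ((2 * (j + 1 : ℝ) + 1) * β) = Real.cos ((2 * j + 1) * β) := by
    intro h1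
    have h1' : (j : ℝ) = n - 1 := by rw [← h1]; push_cast; ring
    rw [h1', show (2 * (n - 1 + 1 : ℝ) + 1) * β = k * Real.pi + β by linear_combination hβ,
      show (2 * (n - 1 : ℝ) + 1) * β = k * Real.pi - β by linear_combination hβ,
      Real.cos_add, Real.cos_sub, Real.sin_nat_mul_pi]
    ring
  have hpred : 0 < j → ((j - 1 : ℕ) : ℝ) = j - 1 := fun h => by
    rw [Nat.cast_sub h, Nat.cast_one]
  split_ifs with h1 h2 h2 <;> norm_cast
  · push_cast [hpred h2]
    linear_combination -hadd
  · have := hleft (by omega)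
    push_cast
    linear_combination -hadd + this
  · have := hright (by omega)
    push_cast [hpred h2]
    linear_combination -hadd + this
  · push_cast
    linear_combination -hadd + hright (by omega) + hleft (by omega)

/-- Pairing a transfer between the edges `{p - 1, p}` and `{q - 1, q}` with the `k`-th
eigenvector. -/
theorem exp_mul_sin_of_transfer {n p q : ℕ} {a b c d : Fin n} (hab : (a : ℕ) + 1 = b)
    (hcd : (c : ℕ) + 1 = d) (hp : (b : ℕ) = p) (hq : (d : ℕ) = q) {t : ℝ} {γ : ℂ}
    (hU : lapTransition (pathGraph n) t *ᵥ pairState a b = γ • pairState c d) {k : ℕ}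
    (hk0 : 0 < k) (hkn : k < n) :
    Complex.exp (Complex.I * t * ((2 - 2 * Real.cos (k * (Real.pi / n)) : ℝ) : ℂ)) *
        ((Real.sin (k * (Real.pi / n) * p) : ℝ) : ℂ) =
      γ * ((Real.sin (k * (Real.pi / n) * q) : ℝ) : ℂ) := by
  have hn : (0 : ℝ) < n := by exact_mod_cast hk0.trans hkn
  set β : ℝ := k * (Real.pi / n) / 2 with hβ
  have h2β : k * (Real.pi / n) = 2 * β := by ring
  have hpi := Real.pi_pos
  have hk : (0 : ℝ) < k := by exact_mod_cast hk0
  have hsin : Real.sin β ≠ 0 := by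
    refine (Real.sin_pos_of_pos_of_lt_pi (by positivity) ?_).ne'
    have : (k : ℝ) < n := by exact_mod_cast hkn
    have : k * (Real.pi / n) < Real.pi := by
      rw [← mul_div_assoc, div_lt_iff₀ hn]
      nlinarith
    linarith
  have hdiff : ∀ {x y : Fin n} {m : ℕ}, (x : ℕ) + 1 = y → (y : ℕ) = m →
      pathCos n β x - pathCos n β y =
        ((2 * Real.sin β : ℝ) : ℂ) * ((Real.sin (k * (Real.pi / n) * m) : ℝ) : ℂ) := by
    intro x y m hxy hm
    rw [pathCos, pathCos, ← Complex.ofReal_sub, ← Complex.ofReal_mul, Real.cos_sub_cos, h2β]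
    have hx : ((x : ℕ) : ℝ) = m - 1 := by rw [← hm, ← hxy]; push_cast; ring
    rw [hm, hx, show ((2 * (m - 1 : ℝ) + 1) * β - (2 * m + 1) * β) / 2 = -β by ring,
      show ((2 * (m - 1 : ℝ) + 1) * β + (2 * m + 1) * β) / 2 = 2 * β * m by ring, Real.sin_neg]
    congr 1
    ring
  have h := exp_mul_sub_of_eigen (lapMatrix_pathGraph_mulVec_pathCos (n := n) (k := k) (β := β)
    (by rw [hβ]; field_simp)) hU
  rw [hdiff hab hp, hdiff hcd hq, ← h2β] at h
  have h2 : ((2 * Real.sin β : ℝ) : ℂ) ≠ 0 := by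
    exact_mod_cast mul_ne_zero two_ne_zero hsin
  exact mul_left_cancel₀ h2 (by linear_combination h)

end Path

/-! ### Rationality of `cos (2π / n) / cos (π / n)` -/

open Polynomial in
/-- An algebraic integer that satisfies `x² = r x + 2` with `r` rational is an integer, or `r` is:
in the second case `X² - r X - 2` is its minimal polynomial. -/
theorem IsIntegral.exists_int_of_sq_eq {x : ℝ} (hx : IsIntegral ℤ x) {r : ℚ}
    (h : x ^ 2 = r * x + 2) : (∃ m : ℤ, x = m) ∨ ∃ m : ℤ, r = m := by
  by_cases hq : ∃ q : ℚ, x = q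
  · left
    obtain ⟨q, rfl⟩ := hq
    have hq' : IsIntegral ℤ q :=
      (isIntegral_algHom_iff (Algebra.ofId ℚ ℝ |>.restrictScalars ℤ)
        (algebraMap ℚ ℝ).injective).1 hx
    obtain ⟨m, hm⟩ := IsIntegrallyClosed.isIntegral_iff.1 hq'
    exact ⟨m, by rw [← hm]; simp⟩
  · right
    have hdeg : (X ^ 2 - (C r * X + C 2)).natDegree = 2 := by compute_degree!
    have hmon : (X ^ 2 - (C r * X + C 2)).Monic := by monicity!
    have hmin : minpoly ℚ x = X ^ 2 - (C r * X + C 2) := by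
      have hxQ : IsIntegral ℚ x := hx.tower_top
      refine (eq_of_monic_of_dvd_of_natDegree_le (minpoly.monic hxQ) hmon
        (minpoly.dvd ℚ x ?_) ?_).symm
      · simp [h]
      · rw [hdeg, minpoly.two_le_natDegree_iff hxQ]
        rintro ⟨q, rfl⟩
        exact hq ⟨q, rfl⟩
    have hcoeff := congrArg (fun p => p.coeff 1) hmin
    simp only [minpoly.isIntegrallyClosed_eq_field_fractions' ℚ hx, coeff_map] at hcoeff
    refine ⟨-(minpoly ℤ x).coeff 1, ?_⟩
    simp [coeff_C] at hcoeff
    push_cast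
    linarith

/-- `2 cos (π / n)` is an algebraic integer in `[1, 2)`, so the only solutions of
`x² = r x + 2` with `r` rational are `1` and `√2`. -/
theorem eq_three_or_four_of_cos_ratio {n : ℕ} (hn : 3 ≤ n) {r : ℚ}
    (h : Real.cos (2 * (Real.pi / n)) = r * Real.cos (Real.pi / n)) : n = 3 ∨ n = 4 := by
  have hn' : (3 : ℝ) ≤ n := by exact_mod_cast hn
  have hn0 : (0 : ℝ) < n := by linarith
  set α := Real.pi / n with hα
  have hpi := Real.pi_pos
  have hα0 : 0 < α := by positivity
  have hα3 : α ≤ Real.pi / 3 := by rw [hα]; gcongr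
  have hge : 1 ≤ 2 * Real.cos α := by
    have := Real.cos_le_cos_of_nonneg_of_le_pi hα0.le (by linarith) hα3
    rw [Real.cos_pi_div_three] at this
    linarith
  have hlt : 2 * Real.cos α < 2 := by
    have := Real.cos_lt_cos_of_nonneg_of_le_pi le_rfl (by linarith) hα0
    rw [Real.cos_zero] at this
    linarith
  have hint : IsIntegral ℤ (2 * Real.cos α) := by
    have := Real.isIntegral_two_mul_cos_rat_mul_pi (1 / n)
    rwa [show ((1 / n : ℚ) : ℝ) * Real.pi = α by push_cast; rw [hα]; ring] at this
  rw [Real.cos_two_mul] at h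
  have hinj : ∀ m : ℕ, 0 < m → Real.cos α = Real.cos (Real.pi / m) → n = m := by
    intro m hm hc
    have hm' : (1 : ℝ) ≤ m := by exact_mod_cast hm
    have := Real.injOn_cos ⟨hα0.le, by linarith⟩
      ⟨by positivity, div_le_self hpi.le hm'⟩ hc
    rw [hα, div_eq_div_iff hn0.ne' (by positivity)] at this
    exact_mod_cast (mul_left_cancel₀ hpi.ne' this).symm
  have hone : 2 * Real.cos α = 1 → n = 3 := fun h1 => hinj 3 (by norm_num) (by
    push_cast
    rw [Real.cos_pi_div_three]
    linarith)
  rcases hint.exists_int_of_sq_eq (r := r) (by linear_combination 2 * h) with ⟨m, hm⟩ | ⟨m, rfl⟩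
  · left
    apply hone
    rw [hm] at hge hlt ⊢
    norm_cast at hge hlt ⊢
    omega
  · push_cast at h
    rcases lt_trichotomy m 0 with hm | rfl | hm
    · left
      have : (m : ℝ) ≤ -1 := by exact_mod_cast Int.le_sub_one_of_lt hm
      apply hone
      nlinarith
    · right
      apply hinj 4 (by norm_num)
      push_cast
      rw [Real.cos_pi_div_four]
      have h2 := Real.sq_sqrt (show (0 : ℝ) ≤ 2 by norm_num)
      have h3 := Real.sqrt_nonneg 2
      push_cast at h
      nlinarith
    · have : (1 : ℝ) ≤ m := by exact_mod_cast hm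
      nlinarith

/-! ### Edges of a path that take part in a transfer -/

section Necessity

open SimpleGraph

/-- On `(0, π)` the sine is injective up to the reflection `x ↦ π - x`. -/
theorem Real.eq_or_add_eq_pi_of_sin_eq {x y : ℝ} (hx : x ∈ Set.Ioo 0 Real.pi)
    (hy : y ∈ Set.Ioo 0 Real.pi) (h : Real.sin x = Real.sin y) : x = y ∨ x + y = Real.pi := by
  obtain ⟨hx0, hx1⟩ := hx
  obtain ⟨hy0, hy1⟩ := hy
  have h' : 2 * Real.sin ((x - y) / 2) * Real.cos ((x + y) / 2) = 0 := by
    rw [← Real.sin_sub_sin, h, sub_self]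
  rcases mul_eq_zero.1 h' with h' | h'
  · left
    have := (Real.sin_eq_zero_iff_of_lt_of_lt (by linarith) (by linarith)).1
      ((mul_eq_zero.1 h').resolve_left two_ne_zero)
    linarith
  · right
    have := Real.injOn_cos (x₁ := (x + y) / 2) (x₂ := Real.pi / 2) ⟨by linarith, by linarith⟩
      ⟨by linarith, by linarith⟩ (by rw [h', Real.cos_pi_div_two])
    linarith

theorem Complex.exists_int_of_exp_sq_eq {x y : ℝ} {γ : ℂ}
    (hx : Complex.exp (Complex.I * x) ^ 2 = γ) (hy : Complex.exp (Complex.I * y) ^ 2 = γ) :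
    ∃ m : ℤ, x - y = m * Real.pi := by
  rw [← hy, ← Complex.exp_nat_mul, ← Complex.exp_nat_mul, Complex.exp_eq_exp_iff_exists_int] at hx
  obtain ⟨m, hm⟩ := hx
  refine ⟨m, ?_⟩
  have h : ((x - y : ℝ) : ℂ) = ((m * Real.pi : ℝ) : ℂ) := by
    push_cast at hm ⊢
    refine mul_left_cancel₀ (mul_ne_zero two_ne_zero Complex.I_ne_zero) ?_
    linear_combination hm
  exact_mod_cast h

/-- If an edge of a path is transferred to another edge, then the eigenvector of the smallest
positive eigenvalue shows that the two edges are mirror images of each other, and periodicity on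
the eigenvectors `1`, `2`, `n - 1`, `n - 2` makes `cos (2π / n) / cos (π / n)` rational. -/
theorem PairTransferAt.add_eq_and_eq_three_or_four {n : ℕ} {t : ℝ} {a b c d : Fin n}
    (h : PairTransferAt (pathGraph n) t a b c d) (hab : (a : ℕ) + 1 = b)
    (hcd : (c : ℕ) + 1 = d) : (b : ℕ) + d = n ∧ (n = 3 ∨ n = 4) := by
  obtain ⟨-, -, hne, ht, γ, hγ, hU⟩ := h
  obtain ⟨p, hp⟩ : ∃ p : ℕ, (b : ℕ) = p := ⟨_, rfl⟩
  obtain ⟨q, hq⟩ : ∃ q : ℕ, (d : ℕ) = q := ⟨_, rfl⟩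
  have hbn := b.2
  have hdn := d.2
  have hpq : p ≠ q := by
    rintro rfl
    exact hne (by rw [Fin.ext (hp.trans hq.symm), Fin.ext (show (a : ℕ) = c by omega)])
  have hn3 : 3 ≤ n := by omega
  have key := fun k => exp_mul_sin_of_transfer hab hcd hp hq hU (k := k)
  set α : ℝ := Real.pi / n with hα
  have hn : (0 : ℝ) < n := by exact_mod_cast (by omega : 0 < n)
  have hpi := Real.pi_pos
  have hαn : α * n = Real.pi := by rw [hα]; field_simp
  have hα0 : 0 < α := by positivity
  have hmem : ∀ {m : ℕ}, 0 < m → m < n → α * m ∈ Set.Ioo 0 Real.pi := by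
    intro m hm hmn
    have h1 : (0 : ℝ) < m := by exact_mod_cast hm
    have h2 : (m : ℝ) < n := by exact_mod_cast hmn
    exact ⟨by positivity, by rw [← hαn]; gcongr⟩
  have hpm := hmem (m := p) (by omega) (by omega)
  have hqm := hmem (m := q) (by omega) (by omega)
  have hsinp := Real.sin_pos_of_mem_Ioo hpm
  have hsinq := Real.sin_pos_of_mem_Ioo hqm
  have hnormexp : ∀ x : ℝ, ‖Complex.exp (Complex.I * t * (x : ℂ))‖ = 1 := by
    intro x
    rw [show Complex.I * t * (x : ℂ) = ((t * x : ℝ) : ℂ) * Complex.I by push_cast; ring]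
    exact Complex.norm_exp_ofReal_mul_I _
  have hsum : p + q = n := by
    have h1 := congrArg norm (key 1 one_pos (by omega))
    rw [norm_mul, norm_mul, hnormexp, hγ, one_mul, one_mul, Complex.norm_real, Complex.norm_real,
      Nat.cast_one, one_mul, Real.norm_of_nonneg hsinp.le, Real.norm_of_nonneg hsinq.le] at h1
    rcases Real.eq_or_add_eq_pi_of_sin_eq hpm hqm h1 with h2 | h2
    · exact absurd (by exact_mod_cast mul_left_cancel₀ hα0.ne' h2) hpq
    · rw [← mul_add, ← hαn] at h2
      exact_mod_cast mul_left_cancel₀ hα0.ne' h2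
  refine ⟨by omega, ?_⟩
  have hq' : (q : ℝ) = n - p := by rw [← hsum]; push_cast; ring
  -- `p ≠ n / 2`, so the second eigenvector lies in the eigenvalue support of the edge.
  have hsin2p : Real.sin (2 * α * p) ≠ 0 := by
    have hr : 2 * α * p = α * (p - q) + Real.pi := by rw [← hαn, hq']; ring
    rw [hr, Real.sin_add_pi, neg_ne_zero]
    intro h0
    have h1 := (Real.sin_eq_zero_iff_of_lt_of_lt (by nlinarith [hpm.1, hqm.2])
      (by nlinarith [hqm.1, hpm.2])).1 h0
    rcases mul_eq_zero.1 h1 with h2 | h2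
    · exact hα0.ne' h2
    · exact hpq (by exact_mod_cast sub_eq_zero.1 h2)
  have hsin1 : Real.sin (α * q) = Real.sin (α * p) := by
    rw [hq', mul_sub, hαn, Real.sin_pi_sub]
  have hsin2 : Real.sin (2 * α * q) = -Real.sin (2 * α * p) := by
    rw [hq', show 2 * α * (n - p : ℝ) = -(2 * α * p) + 2 * Real.pi by rw [← hαn]; ring,
      Real.sin_add_two_pi, Real.sin_neg]
  have hE1 : Complex.exp (Complex.I * t * ((2 - 2 * Real.cos α : ℝ) : ℂ)) = γ := by
    have h1 := key 1 one_pos (by omega)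
    rw [Nat.cast_one, one_mul, hsin1] at h1
    exact mul_right_cancel₀ (by exact_mod_cast hsinp.ne') h1
  have hE2 : Complex.exp (Complex.I * t * ((2 - 2 * Real.cos (2 * α) : ℝ) : ℂ)) = -γ := by
    have h1 := key 2 two_pos (by omega)
    rw [Nat.cast_two, hsin2] at h1
    refine mul_right_cancel₀ (b := ((Real.sin (2 * α * p) : ℝ) : ℂ)) (by exact_mod_cast hsin2p) ?_
    rw [h1]
    push_cast
    ring
  have ht0 : t ≠ 0 := by
    rintro rfl
    simp only [Complex.ofReal_zero, mul_zero, zero_mul, Complex.exp_zero] at hE1 hE2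
    rw [← hE1] at hE2
    norm_num at hE2
  -- `sin (k m π / n) ^ 2` is the same for `k = j` and `k = n - j`.
  have hE' : ∀ j : ℕ, 0 < j → j < n → Real.sin (j * α * p) ≠ 0 →
      Real.sin (j * α * q) ^ 2 = Real.sin (j * α * p) ^ 2 →
      Complex.exp (Complex.I * ((t * (2 + 2 * Real.cos (j * α)) : ℝ) : ℂ)) ^ 2 = γ ^ 2 := by
    intro j hj hjn hs hsq
    have hcast : ((n - j : ℕ) : ℝ) * α = Real.pi - j * α := by
      rw [Nat.cast_sub hjn.le, sub_mul, mul_comm (n : ℝ), hαn]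
    have hrefl : ∀ m : ℕ, Real.sin (((n - j : ℕ) : ℝ) * α * m) ^ 2 = Real.sin (j * α * m) ^ 2 := by
      intro m
      rw [hcast, sub_mul, mul_comm Real.pi, Real.sin_nat_mul_pi_sub, neg_sq, mul_pow, ← pow_mul,
        mul_comm m 2, pow_mul, neg_one_sq, one_pow, one_mul]
    have h1 := congrArg (· ^ 2) (key (n - j) (by omega) (by omega))
    simp only [mul_pow, ← Complex.ofReal_pow] at h1
    rw [hrefl, hrefl, hsq, hcast, Real.cos_pi_sub] at h1
    have h2 := mul_right_cancel₀ (by exact_mod_cast pow_ne_zero 2 hs) h1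
    rw [← h2]
    congr 2
    push_cast
    ring
  have hE1' := hE' 1 one_pos (by omega) (by simpa using hsinp.ne') (by simp [hsin1])
  have hE2' := hE' 2 two_pos (by omega) (by simpa using hsin2p) (by simp [hsin2])
  have hcosr : ∀ {x : ℝ}, Complex.exp (Complex.I * t * ((2 - 2 * x : ℝ) : ℂ)) ^ 2 = γ ^ 2 →
      Complex.exp (Complex.I * ((t * (2 + 2 * x) : ℝ) : ℂ)) ^ 2 = γ ^ 2 →
      ∃ m : ℤ, 4 * t * x = m * Real.pi := by
    intro x h1 h2
    rw [mul_assoc, ← Complex.ofReal_mul] at h1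
    obtain ⟨m, hm⟩ := Complex.exists_int_of_exp_sq_eq h2 h1
    exact ⟨m, by rw [← hm]; ring⟩
  obtain ⟨m₁, hm₁⟩ := hcosr (by rw [hE1]) (by simpa using hE1')
  obtain ⟨m₂, hm₂⟩ := hcosr (by rw [hE2, neg_sq]) (by simpa using hE2')
  have hcos : 0 < Real.cos α := by
    apply Real.cos_pos_of_mem_Ioo
    have : (3 : ℝ) ≤ n := by exact_mod_cast hn3
    constructor <;> nlinarith
  have hm₁0 : (m₁ : ℝ) ≠ 0 := by
    intro h0
    rw [h0, zero_mul] at hm₁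
    have : 4 * t * Real.cos α ≠ 0 := by positivity
    exact this hm₁
  refine eq_three_or_four_of_cos_ratio hn3 (r := m₂ / m₁) ?_
  push_cast
  rw [← hα, div_mul_eq_mul_div, eq_div_iff hm₁0]
  refine mul_left_cancel₀ (mul_ne_zero (mul_ne_zero four_ne_zero ht0) hpi.ne') ?_
  linear_combination m₁ * Real.pi * hm₂ - m₂ * Real.pi * hm₁

end Necessity

/-! ### The transfers in `P₃` and `P₄` -/

section Sufficiency

open SimpleGraph

theorem pairTransferAt_pathGraph_three :
    PairTransferAt (pathGraph 3) (Real.pi / 2) 0 1 1 2 := by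
  refine ⟨by decide, by decide, by decide, by positivity, Complex.I, by simp, ?_⟩
  -- The edge state is half the sum of eigenvectors with eigenvalues `1` and `3`.
  have h1 : (pathGraph 3).lapMatrix ℂ *ᵥ ![1, 0, -1] = (1 : ℂ) • ![1, 0, -1] := by
    funext i
    rw [lapMatrix_mulVec_apply, degree_pathGraph, neighborFinset_eq_filter, Finset.sum_filter]
    fin_cases i <;> simp [Fin.sum_univ_succ, pathGraph_adj]
  have h3 : (pathGraph 3).lapMatrix ℂ *ᵥ ![1, -2, 1] = (3 : ℂ) • ![1, -2, 1] := by
    funext i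
    rw [lapMatrix_mulVec_apply, degree_pathGraph, neighborFinset_eq_filter, Finset.sum_filter]
    fin_cases i <;> simp [Fin.sum_univ_succ, pathGraph_adj] <;> norm_num
  have hx : pairState (0 : Fin 3) 1 = (1 / 2 : ℂ) • ![1, 0, -1] + (1 / 2 : ℂ) • ![1, -2, 1] := by
    funext i
    fin_cases i <;> simp [pairState]
    norm_num
  have he1 : Complex.exp (Complex.I * ((Real.pi / 2 : ℝ) : ℂ) * 1) = Complex.I := by
    rw [show Complex.I * ((Real.pi / 2 : ℝ) : ℂ) * 1 = Real.pi / 2 * Complex.I by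
      push_cast; ring, Complex.exp_pi_div_two_mul_I]
  have he3 : Complex.exp (Complex.I * ((Real.pi / 2 : ℝ) : ℂ) * 3) = -Complex.I := by
    rw [show Complex.I * ((Real.pi / 2 : ℝ) : ℂ) * 3 =
      Real.pi / 2 * Complex.I + Real.pi * Complex.I by push_cast; ring, Complex.exp_add,
      Complex.exp_pi_div_two_mul_I, Complex.exp_pi_mul_I, mul_neg_one]
  rw [hx, Matrix.mulVec_add, Matrix.mulVec_smul, Matrix.mulVec_smul,
    lapTransition_mulVec_of_eigen h1, lapTransition_mulVec_of_eigen h3, he1, he3]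
  funext i
  fin_cases i <;> simp [pairState] <;> ring

theorem pairTransferAt_pathGraph_four :
    PairTransferAt (pathGraph 4) (Real.sqrt 2 * Real.pi / 2) 0 1 2 3 := by
  obtain ⟨s, hs⟩ : ∃ s : ℂ, s = (Real.sqrt 2 : ℝ) := ⟨_, rfl⟩
  have hs2 : s ^ 2 = 2 := by
    rw [hs, ← Complex.ofReal_pow, Real.sq_sqrt zero_le_two]
    norm_num
  obtain ⟨w, hw⟩ : ∃ w : ℂ, w = Complex.exp ((Real.sqrt 2 * Real.pi : ℝ) * Complex.I) := ⟨_, rfl⟩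
  refine ⟨by decide, by decide, by decide, by positivity, -w, ?_, ?_⟩
  · rw [norm_neg, hw, Complex.norm_exp_ofReal_mul_I]
  -- The edge state is a combination of eigenvectors with eigenvalues `2 - √2`, `2`, `2 + √2`,
  -- whose phases at the given time are `-w`, `w`, `-w`.
  have hanti : ∀ z : ℂ, z ^ 2 = 2 → (pathGraph 4).lapMatrix ℂ *ᵥ ![1, z - 1, 1 - z, -1] =
      (2 - z) • ![1, z - 1, 1 - z, -1] := by
    intro z hz
    funext i
    rw [lapMatrix_mulVec_apply, degree_pathGraph, neighborFinset_eq_filter, Finset.sum_filter]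
    fin_cases i <;> simp [Fin.sum_univ_succ, pathGraph_adj]
    · ring
    · linear_combination hz
    · linear_combination -hz
    · ring
  have hsym : (pathGraph 4).lapMatrix ℂ *ᵥ ![1, -1, -1, 1] = (2 : ℂ) • ![1, -1, -1, 1] := by
    funext i
    rw [lapMatrix_mulVec_apply, degree_pathGraph, neighborFinset_eq_filter, Finset.sum_filter]
    fin_cases i <;> simp [Fin.sum_univ_succ, pathGraph_adj] <;> norm_num
  have hx : pairState (0 : Fin 4) 1 = (1 / 4 : ℂ) • ![1, s - 1, 1 - s, -1] +
      (1 / 4 : ℂ) • ![1, -s - 1, 1 - -s, -1] + (1 / 2 : ℂ) • ![1, -1, -1, 1] := by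
    funext i
    fin_cases i <;> simp [pairState] <;> ring
  have he0 : Complex.exp (Complex.I * ((Real.sqrt 2 * Real.pi / 2 : ℝ) : ℂ) * 2) = w := by
    rw [hw]
    congr 1
    push_cast
    ring
  have he1 : Complex.exp (Complex.I * ((Real.sqrt 2 * Real.pi / 2 : ℝ) : ℂ) * (2 - s)) = -w := by
    rw [show Complex.I * ((Real.sqrt 2 * Real.pi / 2 : ℝ) : ℂ) * (2 - s) =
        (Real.sqrt 2 * Real.pi : ℝ) * Complex.I + -(Real.pi * Complex.I) by
      push_cast
      rw [← hs]
      linear_combination (-Complex.I * Real.pi / 2) * hs2, Complex.exp_add, ← hw,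
      Complex.exp_neg_pi_mul_I, mul_neg_one]
  have he2 : Complex.exp (Complex.I * ((Real.sqrt 2 * Real.pi / 2 : ℝ) : ℂ) * (2 - -s)) = -w := by
    rw [show Complex.I * ((Real.sqrt 2 * Real.pi / 2 : ℝ) : ℂ) * (2 - -s) =
        (Real.sqrt 2 * Real.pi : ℝ) * Complex.I + Real.pi * Complex.I by
      push_cast
      rw [← hs]
      linear_combination (Complex.I * Real.pi / 2) * hs2, Complex.exp_add, ← hw,
      Complex.exp_pi_mul_I, mul_neg_one]
  rw [hx, Matrix.mulVec_add, Matrix.mulVec_add, Matrix.mulVec_smul, Matrix.mulVec_smul,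
    Matrix.mulVec_smul, lapTransition_mulVec_of_eigen (hanti s hs2),
    lapTransition_mulVec_of_eigen (hanti (-s) (by rw [neg_sq, hs2])),
    lapTransition_mulVec_of_eigen hsym, he0, he1, he2]
  funext i
  fin_cases i <;> simp [pairState] <;> ring

end Sufficiency

/-! ### The classification -/

theorem SimpleGraph.pathGraph_adj_iff_exists_sym2 {n : ℕ} {a b : Fin n} :
    (SimpleGraph.pathGraph n).Adj a b ↔
      ∃ a' b' : Fin n, s(a, b) = s(a', b') ∧ (a' : ℕ) + 1 = b' := by
  rw [SimpleGraph.pathGraph_adj]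
  constructor
  · rintro (h | h)
    exacts [⟨a, b, rfl, h⟩, ⟨b, a, Sym2.eq_swap, h⟩]
  · rintro ⟨a', b', h, h'⟩
    rcases Sym2.eq_iff.1 h with ⟨rfl, rfl⟩ | ⟨rfl, rfl⟩
    exacts [Or.inl h', Or.inr h']

/-- In a transfer that involves an edge both pairs are edges, and they are mirror images of each
other; the path has three or four vertices. -/
theorem PairTransfer.exists_mirror_edges {n : ℕ} {a b c d : Fin n}
    (h : PairTransfer (SimpleGraph.pathGraph n) a b c d)
    (hadj : (SimpleGraph.pathGraph n).Adj a b ∨ (SimpleGraph.pathGraph n).Adj c d) :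
    (n = 3 ∨ n = 4) ∧ ∃ a' b' c' d' : Fin n, s(a, b) = s(a', b') ∧ s(c, d) = s(c', d') ∧
      (a' : ℕ) + 1 = b' ∧ (c' : ℕ) + 1 = d' ∧ a' ≠ c' ∧ (b' : ℕ) + d' = n := by
  obtain ⟨t, ht⟩ := h
  have hab : (SimpleGraph.pathGraph n).Adj a b := hadj.elim id ht.symm.adj_of_adj
  obtain ⟨a', b', hab', h1⟩ := SimpleGraph.pathGraph_adj_iff_exists_sym2.1 hab
  obtain ⟨c', d', hcd', h2⟩ := SimpleGraph.pathGraph_adj_iff_exists_sym2.1 (ht.adj_of_adj hab)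
  have ht' := ht.congr_sym2 hab' hcd'
  obtain ⟨hsum, hn⟩ := ht'.add_eq_and_eq_three_or_four h1 h2
  refine ⟨hn, a', b', c', d', hab', hcd', h1, h2, ?_, hsum⟩
  rintro rfl
  exact ht'.2.2.1 (by rw [Fin.ext (h1.symm.trans h2)])

theorem mainTheorem1 :
    (∀ n : ℕ,
      (∃ a b c d : Fin n,
        ((SimpleGraph.pathGraph n).Adj a b ∨ (SimpleGraph.pathGraph n).Adj c d) ∧
          PairTransfer (SimpleGraph.pathGraph n) a b c d) ↔ (n = 3 ∨ n = 4)) ∧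
    (∀ a b c d : Fin 3,
      ((SimpleGraph.pathGraph 3).Adj a b ∨ (SimpleGraph.pathGraph 3).Adj c d) →
        (PairTransfer (SimpleGraph.pathGraph 3) a b c d ↔
          ((s(a, b) = s(0, 1) ∧ s(c, d) = s(1, 2)) ∨
            (s(a, b) = s(1, 2) ∧ s(c, d) = s(0, 1))))) ∧
    PairTransferAt (SimpleGraph.pathGraph 3) (Real.pi / 2) 0 1 1 2 ∧
    (∀ a b c d : Fin 4,
      ((SimpleGraph.pathGraph 4).Adj a b ∨ (SimpleGraph.pathGraph 4).Adj c d) →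
        (PairTransfer (SimpleGraph.pathGraph 4) a b c d ↔
          ((s(a, b) = s(0, 1) ∧ s(c, d) = s(2, 3)) ∨
            (s(a, b) = s(2, 3) ∧ s(c, d) = s(0, 1))))) ∧
    PairTransferAt (SimpleGraph.pathGraph 4) (Real.sqrt 2 * Real.pi / 2) 0 1 2 3 := by
  refine ⟨fun n => ⟨?_, ?_⟩, fun a b c d hadj => ⟨fun h => ?_, ?_⟩,
    pairTransferAt_pathGraph_three, fun a b c d hadj => ⟨fun h => ?_, ?_⟩,
    pairTransferAt_pathGraph_four⟩
  · rintro ⟨a, b, c, d, hadj, h⟩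
    exact (h.exists_mirror_edges hadj).1
  · rintro (rfl | rfl)
    · exact ⟨0, 1, 1, 2, Or.inl (by simp [SimpleGraph.pathGraph_adj]),
        _, pairTransferAt_pathGraph_three⟩
    · exact ⟨0, 1, 2, 3, Or.inl (by simp [SimpleGraph.pathGraph_adj]),
        _, pairTransferAt_pathGraph_four⟩
  · obtain ⟨-, a', b', c', d', hab, hcd, h1, h2, hne, hsum⟩ := h.exists_mirror_edges hadj
    rw [hab, hcd]
    clear hab hcd h hadj
    revert a' b' c' d'
    decide
  · rintro (⟨hab, hcd⟩ | ⟨hab, hcd⟩)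
    · exact ⟨_, pairTransferAt_pathGraph_three.congr_sym2 hab.symm hcd.symm⟩
    · exact ⟨_, pairTransferAt_pathGraph_three.symm.congr_sym2 hab.symm hcd.symm⟩
  · obtain ⟨-, a', b', c', d', hab, hcd, h1, h2, hne, hsum⟩ := h.exists_mirror_edges hadj
    rw [hab, hcd]
    clear hab hcd h hadj
    revert a' b' c' d'
    decide
  · rintro (⟨hab, hcd⟩ | ⟨hab, hcd⟩)
    · exact ⟨_, pairTransferAt_pathGraph_four.congr_sym2 hab.symm hcd.symm⟩
    · exact ⟨_, pairTransferAt_pathGraph_four.symm.congr_sym2 hab.symm hcd.symm⟩
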